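/- Let $\mathbb{K}$ be a commutative ring, $\mathcal{C}$ a finite set (colors of vertices) and $\mathcal{D}$ a set (colors of flags). **Graphs.** A graph $\Gamma$ consists of a finite set $V$ of vertices, a finite set $F$ of flags, a map $\partial:F\to V$ and an involution $s:F\to F$. A flag with $s(f)=f$ is an external line; a pair $\{f,s(f)\}$ with $f\ne s(f)$ is an inner edge, and it is a tadpole if $\partial f=\partial s(f)$. Cutting an inner edge $\{f,s(f)\}$ turns $f$ and $s(f)$ into external lines. The geometric realization of $\Gamma$ is obtained from a point for each vertex and an interval for each inner edge and each external line by gluing according to incidence; $\Gamma$ is connected if its realization is a connected space. $\Gamma$ is 1PI if it is connected, remains connected after cutting any one of its inner edges, has no tadpoles, and has at least two vertices. An enumerated colored graph with $n$ vertices (a diagram) is a graph together with a bijection $V\cong\{1,\dots,n\}$ and coloring maps $V\to\mathcal{C}$, $F\to\mathcal{D}$; let $\mathrm{Dgm}(n)$ be the set of isomorphism classes of these. A diagram is 1PI if its underlying graph is. For a diagram $\Gamma$ and a set $J$ of vertices with consecutive numbers $i,\dots,i+j-1$ ($j\ge 1$), $\Gamma_J$ is the diagram with vertices $J$, renumbered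 monotonically by $1,\dots,j$, and with all flags attached to $J$, where a flag joined in $\Gamma$ with a flag not attached to $J$ becomes an external line. For $L\in\mathcal{C}$, $\Gamma/(J,L)$ is obtained by shrinking $J$ to a single vertex of color $L$, which gets the number $i$, removing all inner edges of $\Gamma_J$, and renumbering the other vertices monotonically. **The contraction operad.** A symmetric operad here is a sequence of $\mathbb{K}$-modules $P(n)$, $n\ge 1$, with right actions of the symmetric groups $S_n$ and bilinear partial compositions $\circ_i:P(n)\times P(j)\to P(n-1+j)$, $1\le i\le n$, subject to the sequential and parallel associativity laws and to equivariance; no unit is required. A suboperad is a sequence of submodules stable under the actions of the $S_n$ and under all $\circ_i$. The universal contraction operad $U$ is $$U(n)=\mathrm{Hom}_{\mathbb{K}}\bigl(\mathbb{K}^{(\mathrm{Dgm}(n))},\mathbb{K}^{(\mathcal{C})}\bigr)=\mathbb{K}^{\mathrm{Dgm}(n)\times\mathcal{C}},\qquad Q(\Gamma)=\sum_{L\in\mathcal{C}}q(\Gamma,L)\,L,$$ whose elements are called contraction maps, with the action $(Q^\sigma)(\Gamma)=Q(\sigma\Gamma)$, where $\sigma\Gamma$ is $\Gamma$ with the vertex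 number $k$ renumbered $\sigma(k)$, and with $$(Q''\circ_i Q')(\Gamma)=\sum_{L\in\mathcal{C}}q'(\Gamma_J,L)\,Q''\bigl(\Gamma/(J,L)\bigr),\qquad J=\{\text{vertices number } i,\dots,i+j-1\},$$ for $Q''\in U(n)$, $Q'\in U(j)$ and $\Gamma\in\mathrm{Dgm}(n-1+j)$. **Corollary.** The system $$U_{\mathrm{1PI}}(n)=\{Q\in U(n)\mid Q(\Gamma)=0 \text{ whenever } \Gamma \text{ is not 1PI}\},\qquad n\ge 1,$$ is a suboperad of $U$. -/

import Mathlib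

/-! ## Symmetric operads (partial compositions, no unit), in arities `n ≥ 1` -/

/-- The set of numbers `i, i+1, …, i+j-1` in `{0, …, m-1}`. -/
def blockSet (m i j : ℕ) : Set (Fin m) := {x | i ≤ (x : ℕ) ∧ (x : ℕ) < i + j}

/-- The `a`-th element `i + a` of the block of length `j` which replaces the slot `i`. -/
def blockIncl {n j m : ℕ} (h : n + j = m + 1) (i : Fin n) (a : Fin j) : Fin m :=
  ⟨i + a, by omega⟩

/-- The position in the block of length `j` at `i` of an element of that block. -/
def blockIndex {m i j : ℕ} (x : blockSet m i j) : Fin j :=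
  ⟨(x : Fin m) - i, by have := x.2.1; have := x.2.2; omega⟩

/-- The monotone surjection from `m = n - 1 + j` numbers onto `n` numbers which sends
`i, …, i+j-1` to `i` and is injective elsewhere. -/
def collapse {n j m : ℕ} (h : n + j = m + 1) (i : Fin n) (x : Fin m) : Fin n :=
  if h1 : (x : ℕ) < i then ⟨x, by omega⟩
  else if h2 : (x : ℕ) < i + j then i
  else ⟨x + 1 - j, by omega⟩

/-- The unique preimage under `collapse` of a number `w ≠ i`. -/
def uncollapse {n j m : ℕ} (h : n + j = m + 1) (i w : Fin n) (hw : w ≠ i) : Fin m :=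
  if h1 : (w : ℕ) < i then ⟨w, by omega⟩
  else ⟨w + j - 1, by have : (w : ℕ) ≠ i := fun e => hw (Fin.ext e); omega⟩

/-- `ρ` is the block permutation `σ ∘_i τ`: the block at `i` is moved to the block at `σ i` and
permuted inside by `τ`, and the remaining elements and the block as a whole are permuted
by `σ`. -/
def IsBlockPerm {n j m : ℕ} (h : n + j = m + 1) (i : Fin n) (σ : Equiv.Perm (Fin n))
    (τ : Equiv.Perm (Fin j)) (ρ : Equiv.Perm (Fin m)) : Prop :=
  (∀ a, ρ (blockIncl h i a) = blockIncl h (σ i) (τ a)) ∧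
  (∀ x, collapse h (σ i) (ρ x) = σ (collapse h i x))

/-- A (not necessarily unital) symmetric operad over `R`, given by its spaces `obj n`, the right
actions `act` of the symmetric groups and the partial compositions `∘_i`. The
arities are `n = 1, 2, …` (`obj 0` plays no role); slots are numbered from `0`; the
hypothesis `n + j = m + 1` stands for `m = n - 1 + j`. -/
structure SymmetricOperad (R : Type*) [CommRing R] where
  obj : ℕ → Type*
  [addCommGroup : ∀ n, AddCommGroup (obj n)]
  [module : ∀ n, Module R (obj n)]
  act : ∀ {n : ℕ}, Equiv.Perm (Fin n) → obj n →ₗ[R] obj n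
  comp : ∀ {n j m : ℕ}, 0 < j → n + j = m + 1 → Fin n → (obj n →ₗ[R] obj j →ₗ[R] obj m)
  act_one : ∀ {n : ℕ} (x : obj n), act 1 x = x
  act_mul : ∀ {n : ℕ} (σ τ : Equiv.Perm (Fin n)) (x : obj n), act (σ * τ) x = act τ (act σ x)
  /-- Sequential composition: `(x ∘_i y) ∘_{i+a} z = x ∘_i (y ∘_a z)`. -/
  comp_seq : ∀ {n j k m p l : ℕ} (hj : 0 < j) (hk : 0 < k) (hp : 0 < p)
    (h₁ : n + j = m + 1) (h₂ : m + k = l + 1) (h₃ : j + k = p + 1) (h₄ : n + p = l + 1)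
    (i : Fin n) (a : Fin j) (x : obj n) (y : obj j) (z : obj k),
    comp hk h₂ (blockIncl h₁ i a) (comp hj h₁ i x y) z = comp hp h₄ i x (comp hk h₃ a y z)
  /-- Parallel composition: `(x ∘_i y) ∘_{i'+j-1} z = (x ∘_{i'} z) ∘_i y` for `i < i'`. -/
  comp_par : ∀ {n j k m p l : ℕ} (hj : 0 < j) (hk : 0 < k)
    (h₁ : n + j = m + 1) (h₂ : m + k = l + 1) (h₃ : n + k = p + 1) (h₄ : p + j = l + 1)
    (i i' : Fin n) (hi : i < i') (x : obj n) (y : obj j) (z : obj k),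
    comp hk h₂ ⟨i' + j - 1, by omega⟩ (comp hj h₁ i x y) z =
      comp hj h₄ ⟨i, by have : (i : ℕ) < i' := hi; omega⟩ (comp hk h₃ i' x z) y
  /-- Equivariance: `x^σ ∘_i y^τ = (x ∘_{σ i} y)^(σ ∘_i τ)`. -/
  comp_act : ∀ {n j m : ℕ} (hj : 0 < j) (h : n + j = m + 1) (i : Fin n)
    (σ : Equiv.Perm (Fin n)) (τ : Equiv.Perm (Fin j)) (ρ : Equiv.Perm (Fin m)),
    IsBlockPerm h i σ τ ρ → ∀ (x : obj n) (y : obj j),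
    comp hj h i (act σ x) (act τ y) = act ρ (comp hj h (σ i) x y)

attribute [instance] SymmetricOperad.addCommGroup SymmetricOperad.module

/-- A family of subsets of the spaces of an operad is a suboperad: the subsets are submodules,
stable under the symmetric groups and under all partial compositions. -/
structure SymmetricOperad.IsSuboperad {R : Type*} [CommRing R] (P : SymmetricOperad R)
    (S : ∀ n, Set (P.obj n)) : Prop where
  zero_mem : ∀ {n : ℕ}, 0 < n → (0 : P.obj n) ∈ S n
  add_mem : ∀ {n : ℕ}, 0 < n → ∀ {x y : P.obj n}, x ∈ S n → y ∈ S n → x + y ∈ S n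
  smul_mem : ∀ {n : ℕ}, 0 < n → ∀ (c : R) {x : P.obj n}, x ∈ S n → c • x ∈ S n
  act_mem : ∀ {n : ℕ}, 0 < n → ∀ (σ : Equiv.Perm (Fin n)) {x : P.obj n},
    x ∈ S n → P.act σ x ∈ S n
  comp_mem : ∀ {n j m : ℕ} (hj : 0 < j) (h : n + j = m + 1) (i : Fin n)
    {x : P.obj n} {y : P.obj j}, x ∈ S n → y ∈ S j → P.comp hj h i x y ∈ S m

/-! ## Graphs -/

/-- A graph with vertex set `V` and set of flags (half-edges) `F`: the flag `f` is attached to the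
vertex `att f` and joined with the flag `join f`. If `join f = f` then `f` is an external line;
otherwise `{f, join f}` is an inner edge. -/
structure FlagGraph (V F : Type*) where
  att : F → V
  join : F → F
  join_join : ∀ f, join (join f) = f

namespace FlagGraph

variable {V W F : Type*}

/-- A point for each vertex and an interval `[0,1]` for each flag. -/
abbrev Cells (V F : Type*) : Type _ := (Σ _ : V, Unit) ⊕ (Σ _ : F, unitInterval)

/-- The gluing: the interval of `f` starts at the vertex of `f`, and the
intervals of the two flags of an inner edge are the same interval with opposite orientations. -/
inductive Glue (G : FlagGraph V F) : Cells V F → Cells V F → Prop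
  | start (f : F) : Glue G (Sum.inr ⟨f, 0⟩) (Sum.inl ⟨G.att f, ()⟩)
  | flip (f : F) (t : unitInterval) (hf : G.join f ≠ f) :
      Glue G (Sum.inr ⟨f, t⟩) (Sum.inr ⟨G.join f, unitInterval.symm t⟩)

/-- The geometric realization, with the quotient topology. -/
abbrev Realization (G : FlagGraph V F) : Type _ := Quot G.Glue

def Connected (G : FlagGraph V F) : Prop := ConnectedSpace G.Realization

/-- There is an inner edge with both ends at the same vertex. -/
def HasTadpole (G : FlagGraph V F) : Prop := ∃ f, G.join f ≠ f ∧ G.att (G.join f) = G.att f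

open Classical in
/-- Cutting the edge of `f`: the flags `f` and `join f` become external lines. -/
noncomputable def cut (G : FlagGraph V F) (f : F) : FlagGraph V F where
  att := G.att
  join g := if g = f ∨ g = G.join f then g else G.join g
  join_join g := by
    have h1 := G.join_join f
    have h2 := G.join_join g
    by_cases h : g = f ∨ g = G.join f
    · simp only [if_pos h]
    · have h' : ¬ (G.join g = f ∨ G.join g = G.join f) := by
        rintro (e | e)
        · exact h (Or.inr (by rw [← e, h2]))
        · exact h (Or.inl (by rw [← h2, e, h1]))
      simp only [if_neg h, if_neg h', h2]

/-- One particle irreducible graphs. -/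
def Is1PI (G : FlagGraph V F) : Prop :=
  G.Connected ∧ (∀ f, G.join f ≠ f → (G.cut f).Connected) ∧ ¬ G.HasTadpole ∧ 2 ≤ Nat.card V

open Classical in
/-- The graph determined by a subset `J` of vertices: flags attached to `J`; flags joined with a
flag outside become external. -/
noncomputable def sub (G : FlagGraph V F) (J : Set V) : FlagGraph J {f // G.att f ∈ J} where
  att f := ⟨G.att f, f.2⟩
  join f := if h : G.att (G.join f) ∈ J then ⟨G.join f, h⟩ else f
  join_join f := by
    by_cases h : G.att (G.join f) ∈ J
    · have h3 := f.2
      simp only [dif_pos h, G.join_join, dif_pos h3]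
    · simp only [dif_neg h]

/-- `f` belongs to an inner edge of the graph determined by `J`. -/
def IsInner (G : FlagGraph V F) (J : Set V) (f : F) : Prop :=
  G.att f ∈ J ∧ G.att (G.join f) ∈ J ∧ f ≠ G.join f

/-- Remove all the inner edges of the graph determined by `J`. -/
def eraseInner (G : FlagGraph V F) (J : Set V) : FlagGraph V {f // ¬ G.IsInner J f} where
  att f := G.att f
  join f := ⟨G.join f, fun h => f.2 ⟨by simpa only [G.join_join] using h.2.1, h.1,
    fun e => h.2.2 (by rw [G.join_join, ← e])⟩⟩
  join_join f := Subtype.ext (G.join_join f)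

/-- Identify or rename vertices along a map. -/
def mapVert (G : FlagGraph V F) (φ : V → W) : FlagGraph W F where
  att f := φ (G.att f)
  join := G.join
  join_join := G.join_join

end FlagGraph

/-! ## Enumerated colored graphs -/

/-- An enumerated colored graph with `n` vertices, colors `C` for the vertices and `D` for the
flags. A vertex is identified with its number, so that the set of vertices is `Fin n`. -/
structure Diagram (C D : Type*) (n : ℕ) where
  Flag : Type
  finite : Finite Flag
  body : FlagGraph (Fin n) Flag
  vcol : Fin n → C
  fcol : Flag → D

namespace Diagram

variable {C D : Type*} {n j m : ℕ}

/-- Isomorphism of enumerated colored graphs. As the enumeration is preserved, the bijection of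
the vertices is the identity. -/
def Iso (Γ Γ' : Diagram C D n) : Prop :=
  ∃ e : Γ.Flag ≃ Γ'.Flag, (∀ f, Γ'.body.att (e f) = Γ.body.att f) ∧
    (∀ f, Γ'.body.join (e f) = e (Γ.body.join f)) ∧
    (∀ v, Γ'.vcol v = Γ.vcol v) ∧ (∀ f, Γ'.fcol (e f) = Γ.fcol f)

instance setoid (C D : Type*) (n : ℕ) : Setoid (Diagram C D n) where
  r := Iso
  iseqv :=
    { refl := fun Γ => ⟨Equiv.refl _, by simp⟩
      symm := by
        rintro Γ Γ' ⟨e, h1, h2, h3, h4⟩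
        refine ⟨e.symm, fun f => ?_, fun f => ?_, fun v => (h3 v).symm, fun f => ?_⟩
        · rw [← h1, e.apply_symm_apply]
        · apply e.injective
          rw [← h2, e.apply_symm_apply, e.apply_symm_apply]
        · rw [← h4, e.apply_symm_apply]
      trans := by
        rintro Γ Γ' Γ'' ⟨e, h1, h2, h3, h4⟩ ⟨e', h1', h2', h3', h4'⟩
        refine ⟨e.trans e', fun f => ?_, fun f => ?_, fun v => ?_, fun f => ?_⟩
        · simp [h1, h1']
        · simp [h2, h2']
        · rw [h3', h3]
        · simp [h4, h4'] }

/-- Renumbering: the vertex with number `k` gets the number `σ k`. -/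
def perm (σ : Equiv.Perm (Fin n)) (Γ : Diagram C D n) : Diagram C D n where
  Flag := Γ.Flag
  finite := Γ.finite
  body := Γ.body.mapVert σ
  vcol v := Γ.vcol (σ.symm v)
  fcol := Γ.fcol

/-- The diagram `Γ_J`, where `J` is the set of the vertices number `i, …, i+j-1`. -/
noncomputable def sub (h : n + j = m + 1) (i : Fin n) (Γ : Diagram C D m) : Diagram C D j where
  Flag := {f // Γ.body.att f ∈ blockSet m i j}
  finite := by have := Γ.finite; infer_instance
  body := (Γ.body.sub (blockSet m i j)).mapVert blockIndex
  vcol a := Γ.vcol (blockIncl h i a)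
  fcol f := Γ.fcol f

/-- The contracted diagram `Γ/(J,L)`, where `J` is the set of the vertices number `i, …, i+j-1`:
`J` is shrunk to one vertex of color `L`, which gets the number `i`, and the inner edges of `Γ_J`
are removed. -/
noncomputable def contract (h : n + j = m + 1) (i : Fin n) (L : C) (Γ : Diagram C D m) :
    Diagram C D n where
  Flag := {f // ¬ Γ.body.IsInner (blockSet m i j) f}
  finite := by have := Γ.finite; infer_instance
  body := (Γ.body.eraseInner (blockSet m i j)).mapVert (collapse h i)
  vcol w := if hw : w = i then L else Γ.vcol (uncollapse h i w hw)
  fcol f := Γ.fcol f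

end Diagram

/-- Isomorphism classes of enumerated colored graphs with `n` vertices. -/
def Dgm (C D : Type*) (n : ℕ) : Type _ := Quotient (Diagram.setoid C D n)

/-! ## The universal contraction operad -/

/-- Auxiliary: `collapse` on natural numbers. -/
def collapseNat (i j x : ℕ) : ℕ := if x < i then x else if x < i + j then i else x + 1 - j

theorem collapseNat_spec (i j x : ℕ) : (x < i ∧ collapseNat i j x = x) ∨
    (i ≤ x ∧ x < i + j ∧ collapseNat i j x = i) ∨
    (i ≤ x ∧ i + j ≤ x ∧ collapseNat i j x = x + 1 - j) := by
  unfold collapseNat; split_ifs <;> omega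

theorem collapseNat_mem_left {i j u k : ℕ} (hj : 0 < j) (hk : 0 < k) (x : ℕ) (h : i + j ≤ u) :
    (i ≤ collapseNat u k x ∧ collapseNat u k x < i + j) ↔ (i ≤ x ∧ x < i + j) := by
  have := collapseNat_spec u k x
  omega

theorem collapseNat_mem_right {w j i k : ℕ} (hj : 0 < j) (x : ℕ) (h : w < i) :
    (i ≤ collapseNat w j x ∧ collapseNat w j x < i + k) ↔
      (i + j - 1 ≤ x ∧ x < i + j - 1 + k) := by
  have := collapseNat_spec w j x
  omega

theorem collapse_val {n j m : ℕ} (h : n + j = m + 1) (i : Fin n) (x : Fin m) :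
    (collapse h i x : ℕ) = collapseNat i j x := by
  unfold collapse collapseNat; split_ifs <;> rfl

theorem uncollapse_val {n j m : ℕ} (h : n + j = m + 1) (i w : Fin n) (hw : w ≠ i) :
    ((w : ℕ) < i ∧ (uncollapse h i w hw : ℕ) = w) ∨
      ((i : ℕ) < w ∧ (uncollapse h i w hw : ℕ) = w + j - 1) := by
  have : (w : ℕ) ≠ i := fun e => hw (Fin.ext e)
  unfold uncollapse; split_ifs <;> simp <;> omega

theorem blockIncl_val {n j m : ℕ} (h : n + j = m + 1) (i : Fin n) (a : Fin j) :
    (blockIncl h i a : ℕ) = i + a := rfl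

theorem collapse_eq_iff {n j m : ℕ} (h : n + j = m + 1) (i : Fin n) (x : Fin m) :
    collapse h i x = i ↔ (i : ℕ) ≤ x ∧ (x : ℕ) < i + j := by
  rw [Fin.ext_iff, collapse_val]
  have := collapseNat_spec i j x
  omega

theorem collapse_uncollapse {n j m : ℕ} (hj : 0 < j) (h : n + j = m + 1) (i w : Fin n)
    (hw : w ≠ i) : collapse h i (uncollapse h i w hw) = w := by
  have : (w : ℕ) ≠ i := fun e => hw (Fin.ext e)
  rw [Fin.ext_iff, collapse_val]
  have h1 := collapseNat_spec i j (uncollapse h i w hw)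
  have h2 := uncollapse_val h i w hw
  omega

theorem eq_uncollapse {n j m : ℕ} (h : n + j = m + 1) (i w : Fin n) (hw : w ≠ i) (x : Fin m)
    (hx : collapse h i x = w) : x = uncollapse h i w hw := by
  have : (w : ℕ) ≠ i := fun e => hw (Fin.ext e)
  rw [Fin.ext_iff, collapse_val] at hx
  have h1 := collapseNat_spec i j x
  have h2 := uncollapse_val h i w hw
  rw [Fin.ext_iff]
  omega

theorem FlagGraph.sub_join_pos {V F : Type*} (G : FlagGraph V F) (J : Set V)
    (f : {f // G.att f ∈ J}) (h : G.att (G.join f) ∈ J) :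
    ((G.sub J).join f).1 = G.join f := by
  simp only [FlagGraph.sub, dif_pos h]

theorem FlagGraph.sub_join_neg {V F : Type*} (G : FlagGraph V F) (J : Set V)
    (f : {f // G.att f ∈ J}) (h : ¬ G.att (G.join f) ∈ J) :
    ((G.sub J).join f).1 = f.1 := by
  simp only [FlagGraph.sub, dif_neg h]

namespace Diagram

variable {C D : Type*} {n j m k p l : ℕ}

/-- Auxiliary: the flags of `Γ` are embedded by `ι` into `F` with image `P`, and `A`, `J`, `φ`
express the attaching map (as a number), the joining map and the colors on the image. -/
structure Rep {F : Type} (Γ : Diagram C D n) (ι : Γ.Flag → F) (P : F → Prop) (A : F → ℕ)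
    (J : F → F) (φ : F → D) : Prop where
  inj : Function.Injective ι
  range : ∀ g, P g ↔ ∃ f, ι f = g
  att : ∀ f, (Γ.body.att f : ℕ) = A (ι f)
  join : ∀ f, ι (Γ.body.join f) = J (ι f)
  col : ∀ f, Γ.fcol f = φ (ι f)

theorem Rep.self (Γ : Diagram C D n) :
    Γ.Rep id (fun _ => True) (fun f => Γ.body.att f) Γ.body.join Γ.fcol where
  inj := Function.injective_id
  range g := by simp
  att _ := rfl
  join _ := rfl
  col _ := rfl

theorem Rep.iso {Γ Γ' : Diagram C D n} {F : Type} {ι : Γ.Flag → F} {ι' : Γ'.Flag → F}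
    {P P' : F → Prop} {A A' : F → ℕ} {J J' : F → F} {φ : F → D}
    (r : Γ.Rep ι P A J φ) (r' : Γ'.Rep ι' P' A' J' φ) (hP : ∀ g, P g ↔ P' g)
    (hA : ∀ g, P g → A g = A' g) (hJ : ∀ g, P g → J g = J' g)
    (hv : ∀ v, Γ'.vcol v = Γ.vcol v) : Γ ≈ Γ' := by
  have hPι : ∀ f, P (ι f) := fun f => (r.range _).2 ⟨f, rfl⟩
  have h12 : ∀ f, ∃ g, ι' g = ι f := fun f => (r'.range _).1 ((hP _).1 (hPι f))
  choose e he using h12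
  have hb : Function.Bijective e := by
    refine ⟨fun f f' h => r.inj (by rw [← he, ← he, h]), fun g => ?_⟩
    obtain ⟨f, hf⟩ := (r.range (ι' g)).1 ((hP _).2 ((r'.range _).2 ⟨g, rfl⟩))
    exact ⟨f, r'.inj (by rw [he, hf])⟩
  refine ⟨Equiv.ofBijective e hb, fun f => Fin.ext ?_, fun f => r'.inj ?_, hv, fun f => ?_⟩
  · change (Γ'.body.att (e f) : ℕ) = _
    rw [r'.att, r.att, he, hA _ (hPι f)]
  · change ι' (Γ'.body.join (e f)) = ι' (e (Γ.body.join f))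
    rw [r'.join, he, he, r.join, hJ _ (hPι f)]
  · change Γ'.fcol (e f) = _
    rw [r'.col, he, r.col]

theorem Rep.perm {F : Type} {Γ : Diagram C D n} {ι : Γ.Flag → F} {P : F → Prop}
    {A A' : F → ℕ} {J : F → F} {φ : F → D} (r : Γ.Rep ι P A J φ) (σ : Equiv.Perm (Fin n))
    (hA : ∀ f, (σ (Γ.body.att f) : ℕ) = A' (ι f)) : (Γ.perm σ).Rep ι P A' J φ where
  inj := r.inj
  range := r.range
  att := hA
  join := r.join
  col := r.col

theorem Rep.sub {F : Type} {Γ : Diagram C D m} {ι : Γ.Flag → F} {P : F → Prop}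
    {A : F → ℕ} {J : F → F} {φ : F → D} (r : Γ.Rep ι P A J φ) (h : n + j = m + 1)
    (i : Fin n) :
    (Γ.sub h i).Rep (fun f => ι f.1) (fun g => P g ∧ i ≤ A g ∧ A g < i + j)
      (fun g => A g - i) (fun g => if i ≤ A (J g) ∧ A (J g) < i + j then J g else g) φ where
  inj f g h := Subtype.ext (r.inj h)
  range g := by
    constructor
    · rintro ⟨hP, h1⟩
      obtain ⟨f, rfl⟩ := (r.range g).1 hP
      rw [← r.att] at h1
      exact ⟨⟨f, h1⟩, rfl⟩
    · rintro ⟨f, rfl⟩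
      refine ⟨(r.range _).2 ⟨f.1, rfl⟩, ?_⟩
      rw [← r.att]
      exact f.2
  att f := by
    change (Γ.body.att f.1 : ℕ) - i = _
    rw [r.att]
  join f := by
    change ι (Γ.body.sub (blockSet m i j) |>.join f).1 = _
    have e : A (J (ι f.1)) = (Γ.body.att (Γ.body.join f.1) : ℕ) := by rw [r.att, r.join]
    rw [e]
    by_cases c : Γ.body.att (Γ.body.join f.1) ∈ blockSet m i j
    · rw [if_pos (show _ ∧ _ from c)]
      rw [Γ.body.sub_join_pos _ f c, r.join]
    · rw [if_neg (show ¬ (_ ∧ _) from c)]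
      rw [Γ.body.sub_join_neg _ f c]
  col f := r.col f.1

theorem Rep.contract {F : Type} {Γ : Diagram C D m} {ι : Γ.Flag → F} {P : F → Prop}
    {A : F → ℕ} {J : F → F} {φ : F → D} (r : Γ.Rep ι P A J φ) (h : n + j = m + 1)
    (i : Fin n) (L : C) :
    (Γ.contract h i L).Rep (fun f => ι f.1)
      (fun g => P g ∧ ¬ ((i ≤ A g ∧ A g < i + j) ∧ (i ≤ A (J g) ∧ A (J g) < i + j) ∧ g ≠ J g))
      (fun g => collapseNat i j (A g)) J φ where
  inj f g h := Subtype.ext (r.inj h)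
  range g := by
    have key : ∀ f, Γ.body.IsInner (blockSet m i j) f ↔
        ((i ≤ A (ι f) ∧ A (ι f) < i + j) ∧ (i ≤ A (J (ι f)) ∧ A (J (ι f)) < i + j) ∧
          ι f ≠ J (ι f)) := by
      intro f
      rw [← r.join, ← r.att, ← r.att, r.inj.ne_iff]
      rfl
    constructor
    · rintro ⟨hP, h1⟩
      obtain ⟨f, rfl⟩ := (r.range g).1 hP
      rw [← key] at h1
      exact ⟨⟨f, h1⟩, rfl⟩
    · rintro ⟨f, rfl⟩
      refine ⟨(r.range _).2 ⟨f.1, rfl⟩, ?_⟩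
      rw [← key]
      exact f.2
  att f := by
    change (collapse h i (Γ.body.att f.1) : ℕ) = _
    rw [collapse_val, r.att]
  join f := r.join f.1
  col f := r.col f.1

theorem Rep.of_iso {Γ Γ' : Diagram C D n} (e : Γ ≈ Γ') : ∃ ι : Γ.Flag → Γ'.Flag,
    Γ.Rep ι (fun _ => True) (fun f => Γ'.body.att f) Γ'.body.join Γ'.fcol := by
  obtain ⟨e, h1, h2, h3, h4⟩ := e
  exact ⟨e, e.injective, fun g => ⟨fun _ => e.surjective g, fun _ => trivial⟩,
    fun f => by rw [h1], fun f => (h2 f).symm, fun f => (h4 f).symm⟩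

theorem vcol_of_iso {Γ Γ' : Diagram C D n} (e : Γ ≈ Γ') (v : Fin n) :
    Γ'.vcol v = Γ.vcol v := by
  obtain ⟨e, h1, h2, h3, h4⟩ := e
  exact h3 v

theorem perm_congr (σ : Equiv.Perm (Fin n)) {Γ Γ' : Diagram C D n} (e : Γ ≈ Γ') :
    Γ.perm σ ≈ Γ'.perm σ := by
  obtain ⟨e, h1, h2, h3, h4⟩ := e
  exact ⟨e, fun f => congrArg σ (h1 f), h2, fun v => h3 _, h4⟩

theorem sub_congr (h : n + j = m + 1) (i : Fin n) {Γ Γ' : Diagram C D m} (e : Γ ≈ Γ') :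
    Γ.sub h i ≈ Γ'.sub h i := by
  obtain ⟨ι, r⟩ := Rep.of_iso e
  exact (r.sub h i).iso ((Rep.self Γ').sub h i) (fun _ => Iff.rfl) (fun _ _ => rfl)
    (fun _ _ => rfl) (fun v => vcol_of_iso e _)

theorem contract_congr (h : n + j = m + 1) (i : Fin n) (L : C) {Γ Γ' : Diagram C D m}
    (e : Γ ≈ Γ') : Γ.contract h i L ≈ Γ'.contract h i L := by
  obtain ⟨ι, r⟩ := Rep.of_iso e
  exact (r.contract h i L).iso ((Rep.self Γ').contract h i L) (fun _ => Iff.rfl)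
    (fun _ _ => rfl) (fun _ _ => rfl) (fun v => by
      simp only [Diagram.contract, vcol_of_iso e])

theorem sub_sub (h₁ : n + j = m + 1) (h₂ : m + k = l + 1) (h₃ : j + k = p + 1)
    (h₄ : n + p = l + 1) (i : Fin n) (a : Fin j) (Γ : Diagram C D l) :
    (Γ.sub h₄ i).sub h₃ a ≈ Γ.sub h₂ (blockIncl h₁ i a) := by
  have ha := a.2
  have hi := i.2
  have hb : (blockIncl h₁ i a : ℕ) = i + a := rfl
  refine (((Rep.self Γ).sub h₄ i).sub h₃ a).iso ((Rep.self Γ).sub h₂ _) ?_ ?_ ?_ ?_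
  · intro g; simp only [hb, true_and]; omega
  · intro g _; simp only [hb]; omega
  · intro g; simp only [hb, true_and]
    intro hg
    split_ifs <;> first | rfl | omega
  · intro v
    change Γ.vcol _ = Γ.vcol _
    congr 1
    apply Fin.ext
    simp only [blockIncl]; omega

theorem sub_contract (hj : 0 < j) (h₁ : n + j = m + 1) (h₂ : m + k = l + 1) (h₃ : j + k = p + 1)
    (h₄ : n + p = l + 1) (i : Fin n) (a : Fin j) (M : C) (Γ : Diagram C D l) :
    (Γ.sub h₄ i).contract h₃ a M ≈ (Γ.contract h₂ (blockIncl h₁ i a) M).sub h₁ i := by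
  have ha := a.2
  have hi := i.2
  have hb : (blockIncl h₁ i a : ℕ) = i + a := rfl
  refine (((Rep.self Γ).sub h₄ i).contract h₃ a M).iso
    (((Rep.self Γ).contract h₂ _ M).sub h₁ i) ?_ ?_ ?_ ?_
  · intro g
    have s1 := collapseNat_spec (i + a) k (Γ.body.att g)
    simp only [hb, true_and]
    by_cases e : g = Γ.body.join g
    · simp only [← e, ne_eq, not_true_eq_false, and_false, not_false_eq_true, and_true,
        true_and, ite_self]
      omega
    · simp only [ne_eq]
      split_ifs <;> simp only [e, not_true_eq_false, and_false, not_false_eq_true, and_true] <;> omega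
  · intro g
    have s1 := collapseNat_spec (i + a) k (Γ.body.att g)
    have s2 := collapseNat_spec a k (Γ.body.att g - i)
    simp only [hb, true_and]
    intro hg
    omega
  · intro g
    have s1 := collapseNat_spec (i + a) k (Γ.body.att (Γ.body.join g))
    simp only [hb, true_and]
    intro hg
    split_ifs <;> first | rfl | omega
  · intro v
    have hv := v.2
    simp only [Diagram.contract, Diagram.sub]
    by_cases c : v = a
    · subst c; simp
    · have d : (v : ℕ) ≠ a := fun e => c (Fin.ext e)
      have hb' : (blockIncl h₁ i v : ℕ) = i + v := rfl
      have c' : ¬ (blockIncl h₁ i v = blockIncl h₁ i a) := by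
        rw [Fin.ext_iff]; omega
      rw [dif_neg c, dif_neg c']
      congr 1
      have u1 := uncollapse_val h₂ _ _ c'
      have u2 := uncollapse_val h₃ _ _ c
      rw [Fin.ext_iff, blockIncl_val]
      omega

theorem contract_contract (hj : 0 < j) (hk : 0 < k) (h₁ : n + j = m + 1) (h₂ : m + k = l + 1)
    (h₃ : j + k = p + 1) (h₄ : n + p = l + 1) (i : Fin n) (a : Fin j) (L M : C)
    (Γ : Diagram C D l) :
    (Γ.contract h₂ (blockIncl h₁ i a) M).contract h₁ i L ≈ Γ.contract h₄ i L := by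
  have ha := a.2
  have hi := i.2
  have hb : (blockIncl h₁ i a : ℕ) = i + a := rfl
  refine (((Rep.self Γ).contract h₂ _ M).contract h₁ i L).iso
    ((Rep.self Γ).contract h₄ i L) ?_ ?_ (fun _ _ => rfl) ?_
  · intro g
    have s1 := collapseNat_spec (i + a) k (Γ.body.att g)
    have s2 := collapseNat_spec (i + a) k (Γ.body.att (Γ.body.join g))
    simp only [hb, true_and]
    generalize (g ≠ Γ.body.join g) = q
    by_cases e : q <;> simp only [e, and_false, not_false_eq_true, and_true]
    omega
  · intro g _
    have s1 := collapseNat_spec (i + a) k (Γ.body.att g)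
    have s2 := collapseNat_spec i j (collapseNat (i + a) k (Γ.body.att g))
    have s3 := collapseNat_spec i p (Γ.body.att g)
    simp only [hb]
    omega
  · intro v
    have hv := v.2
    simp only [Diagram.contract]
    by_cases c : v = i
    · subst c; simp
    · have : (v : ℕ) ≠ i := fun e => c (Fin.ext e)
      have u1 := uncollapse_val h₁ _ _ c
      have u2 := uncollapse_val h₄ _ _ c
      have c' : ¬ (uncollapse h₁ i v c = blockIncl h₁ i a) := by
        rw [Fin.ext_iff]; omega
      have u3 := uncollapse_val h₂ _ _ c'
      rw [dif_neg c, dif_neg c, dif_neg c']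
      congr 1
      rw [Fin.ext_iff]
      omega

theorem contract_sub_left (hj : 0 < j) (hk : 0 < k) (h₁ : n + j = m + 1) (h₂ : m + k = l + 1)
    (h₄ : p + j = l + 1) (i : Fin n) (u : Fin m) (w : Fin p) (hw : (w : ℕ) = i)
    (hu : (i : ℕ) + j ≤ u) (M : C) (Γ : Diagram C D l) :
    (Γ.contract h₂ u M).sub h₁ i ≈ Γ.sub h₄ w := by
  have hi := i.2
  refine (((Rep.self Γ).contract h₂ u M).sub h₁ i).iso ((Rep.self Γ).sub h₄ w) ?_ ?_ ?_ ?_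
  · intro g
    have s1 := collapseNat_spec u k (Γ.body.att g)
    simp only [hw, true_and]
    omega
  · intro g
    have s1 := collapseNat_spec u k (Γ.body.att g)
    simp only [hw, true_and]
    omega
  · intro g
    have s1 := collapseNat_spec u k (Γ.body.att (Γ.body.join g))
    simp only [hw, true_and]
    intro hg
    split_ifs <;> first | rfl | omega
  · intro v
    have hv := v.2
    have hb : (blockIncl h₁ i v : ℕ) = i + v := rfl
    have c : ¬ (blockIncl h₁ i v = u) := by
      rw [Fin.ext_iff]; omega
    have u1 := uncollapse_val h₂ _ _ c
    simp only [Diagram.contract, Diagram.sub]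
    rw [dif_neg c]
    congr 1
    rw [Fin.ext_iff, blockIncl_val]
    omega

theorem contract_sub_right (hj : 0 < j) (hk : 0 < k) (h₂ : m + k = l + 1)
    (h₃ : n + k = p + 1) (h₄ : p + j = l + 1) (i' : Fin n) (u : Fin m) (w : Fin p)
    (hw : (w : ℕ) < i') (hu : (u : ℕ) = i' + j - 1) (L : C) (Γ : Diagram C D l) :
    (Γ.contract h₄ w L).sub h₃ i' ≈ Γ.sub h₂ u := by
  refine (((Rep.self Γ).contract h₄ w L).sub h₃ i').iso ((Rep.self Γ).sub h₂ u) ?_ ?_ ?_ ?_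
  · intro g
    have s1 := collapseNat_spec w j (Γ.body.att g)
    simp only [hu, true_and]
    omega
  · intro g
    have s1 := collapseNat_spec w j (Γ.body.att g)
    simp only [hu, true_and]
    omega
  · intro g
    have s1 := collapseNat_spec w j (Γ.body.att (Γ.body.join g))
    simp only [hu, true_and]
    intro hg
    split_ifs <;> first | rfl | omega
  · intro v
    have hv := v.2
    have hb : (blockIncl h₃ i' v : ℕ) = i' + v := rfl
    have c : ¬ (blockIncl h₃ i' v = w) := by
      rw [Fin.ext_iff]; omega
    have u1 := uncollapse_val h₄ _ _ c
    simp only [Diagram.contract, Diagram.sub]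
    rw [dif_neg c]
    congr 1
    rw [Fin.ext_iff, blockIncl_val]
    omega

theorem contract_comm (hj : 0 < j) (hk : 0 < k) (h₁ : n + j = m + 1) (h₂ : m + k = l + 1)
    (h₃ : n + k = p + 1) (h₄ : p + j = l + 1) (i i' : Fin n) (u : Fin m) (w : Fin p)
    (hi : (i : ℕ) < i') (hw : (w : ℕ) = i) (hu : (u : ℕ) = i' + j - 1) (L M : C)
    (Γ : Diagram C D l) :
    (Γ.contract h₂ u M).contract h₁ i L ≈ (Γ.contract h₄ w L).contract h₃ i' M := by
  refine (((Rep.self Γ).contract h₂ u M).contract h₁ i L).iso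
    (((Rep.self Γ).contract h₄ w L).contract h₃ i' M) ?_ ?_ (fun _ _ => rfl) ?_
  · intro g
    have b1 := fun x => collapseNat_mem_left hj hk x (show (i : ℕ) + j ≤ u by omega)
    have b2 := fun x => collapseNat_mem_right (k := k) hj x (show (w : ℕ) < i' by omega)
    rw [← hu] at b2
    rw [hw] at b2
    simp only [true_and, b1, b2, hw]
    exact and_comm
  · intro g _
    have s1 := collapseNat_spec u k (Γ.body.att g)
    have s2 := collapseNat_spec i j (collapseNat u k (Γ.body.att g))
    have s3 := collapseNat_spec w j (Γ.body.att g)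
    have s4 := collapseNat_spec i' k (collapseNat w j (Γ.body.att g))
    omega
  · intro v
    have hv := v.2
    simp only [Diagram.contract]
    by_cases c : v = i
    · have c1 : ¬ (v = i') := by rintro rfl; subst c; omega
      have c2 : uncollapse h₃ i' v c1 = w := by
        have u1 := uncollapse_val h₃ _ _ c1
        have c3 := congrArg Fin.val c
        rw [Fin.ext_iff]
        omega
      rw [dif_pos c, dif_neg c1, dif_pos c2]
    · have d : (v : ℕ) ≠ i := fun e => c (Fin.ext e)
      have u1 := uncollapse_val h₁ _ _ c
      by_cases c1 : v = i'
      · have c2 : uncollapse h₁ i v c = u := by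
          have c3 := congrArg Fin.val c1
          rw [Fin.ext_iff]
          omega
        rw [dif_neg c, dif_pos c1, dif_pos c2]
      · have d1 : (v : ℕ) ≠ i' := fun e => c1 (Fin.ext e)
        have u2 := uncollapse_val h₃ _ _ c1
        have c2 : ¬ (uncollapse h₁ i v c = u) := by
          rw [Fin.ext_iff]; omega
        have c3 : ¬ (uncollapse h₃ i' v c1 = w) := by
          rw [Fin.ext_iff]; omega
        have u3 := uncollapse_val h₂ _ _ c2
        have u4 := uncollapse_val h₄ _ _ c3
        rw [dif_neg c, dif_neg c1, dif_neg c2, dif_neg c3]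
        congr 1
        rw [Fin.ext_iff]
        omega

theorem mem_block_perm {h : n + j = m + 1} {i : Fin n} {σ : Equiv.Perm (Fin n)}
    {τ : Equiv.Perm (Fin j)} {ρ : Equiv.Perm (Fin m)} (hρ : IsBlockPerm h i σ τ ρ) (x : Fin m) :
    ((i : ℕ) ≤ x ∧ (x : ℕ) < i + j) ↔ ((σ i : ℕ) ≤ ρ x ∧ (ρ x : ℕ) < σ i + j) := by
  rw [← collapse_eq_iff h i x, ← collapse_eq_iff h (σ i) (ρ x), hρ.2, σ.injective.eq_iff]

theorem perm_sub {h : n + j = m + 1} {i : Fin n} {σ : Equiv.Perm (Fin n)}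
    {τ : Equiv.Perm (Fin j)} {ρ : Equiv.Perm (Fin m)} (hρ : IsBlockPerm h i σ τ ρ)
    (Γ : Diagram C D m) : (Γ.sub h i).perm τ ≈ (Γ.perm ρ).sub h (σ i) := by
  have r := (Rep.self Γ).perm ρ (A' := fun f => ρ (Γ.body.att f)) (fun _ => rfl)
  refine (((Rep.self Γ).sub h i).perm τ (A' := fun f => ρ (Γ.body.att f) - σ i) ?_).iso
    (r.sub h (σ i)) ?_ (fun _ _ => rfl) ?_ ?_
  · intro f
    have hf := f.2
    have e : blockIncl h i ((Γ.sub h i).body.att f) = Γ.body.att f.1 := by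
      apply Fin.ext
      change (i : ℕ) + (Γ.body.att f.1 - i) = _
      have := hf.1
      omega
    change _ = (ρ (Γ.body.att f.1) : ℕ) - σ i
    rw [← e, hρ.1, blockIncl_val]
    omega
  · intro g
    simp only [mem_block_perm hρ]
  · intro g _
    simp only [mem_block_perm hρ]
  · intro v
    change Γ.vcol (ρ.symm _) = Γ.vcol _
    congr 1
    rw [Equiv.symm_apply_eq, hρ.1, Equiv.apply_symm_apply]

theorem perm_contract (hj : 0 < j) {h : n + j = m + 1} {i : Fin n} {σ : Equiv.Perm (Fin n)}
    {τ : Equiv.Perm (Fin j)} {ρ : Equiv.Perm (Fin m)} (hρ : IsBlockPerm h i σ τ ρ) (L : C)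
    (Γ : Diagram C D m) :
    (Γ.contract h i L).perm σ ≈ (Γ.perm ρ).contract h (σ i) L := by
  have r := (Rep.self Γ).perm ρ (A' := fun f => ρ (Γ.body.att f)) (fun _ => rfl)
  refine (((Rep.self Γ).contract h i L).perm σ
    (A' := fun f => σ (collapse h i (Γ.body.att f))) (fun _ => rfl)).iso
    (r.contract h (σ i) L) ?_ ?_ (fun _ _ => rfl) ?_
  · intro g
    simp only [mem_block_perm hρ]
  · intro g _
    rw [← hρ.2, collapse_val]
  · intro v
    simp only [Diagram.contract, Diagram.perm]
    by_cases c : v = σ i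
    · have c' : σ.symm v = i := by rw [Equiv.symm_apply_eq, c]
      rw [dif_pos c, dif_pos c']
    · have c' : ¬ (σ.symm v = i) := by rwa [Equiv.symm_apply_eq]
      rw [dif_neg c, dif_neg c']
      congr 1
      apply eq_uncollapse
      rw [← σ.injective.eq_iff, ← hρ.2, Equiv.apply_symm_apply, Equiv.apply_symm_apply,
        collapse_uncollapse hj]

end Diagram

namespace Dgm

variable {C D : Type*} {n j m : ℕ}

/-- The action of permutations on diagrams, by renumbering the vertices. -/
def perm (σ : Equiv.Perm (Fin n)) : Dgm C D n → Dgm C D n :=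
  Quotient.map (Diagram.perm σ) fun _ _ => Diagram.perm_congr σ

/-- `Γ ↦ Γ_J`, where `J` is the set of the vertices number `i, …, i+j-1`. -/
noncomputable def sub (h : n + j = m + 1) (i : Fin n) : Dgm C D m → Dgm C D j :=
  Quotient.map (Diagram.sub h i) fun _ _ => Diagram.sub_congr h i

/-- `Γ ↦ Γ/(J,L)`, where `J` is the set of the vertices number `i, …, i+j-1`. -/
noncomputable def contract (h : n + j = m + 1) (i : Fin n) (L : C) : Dgm C D m → Dgm C D n :=
  Quotient.map (Diagram.contract h i L) fun _ _ => Diagram.contract_congr h i L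

end Dgm

/-- Contraction maps: `Q Γ L` is the coefficient of the color `L` in `Q Γ = ∑ L, Q Γ L • L`.
(For finite `C`, these are the linear maps from the free module on the diagrams
with `n` vertices to the free module on `C`.) -/
abbrev ContractionMap (R C D : Type*) (n : ℕ) : Type _ := Dgm C D n → C → R

section ContractionOperad

variable (R C D : Type*) [CommRing R] [Fintype C]

/-- `(Q^σ)(Γ) = Q(σ Γ)`. -/
def contractionAct {n : ℕ} (σ : Equiv.Perm (Fin n)) :
    ContractionMap R C D n →ₗ[R] ContractionMap R C D n where
  toFun Q Γ := Q (Γ.perm σ)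
  map_add' _ _ := rfl
  map_smul' _ _ := rfl

/-- `(Q'' ∘_i Q')(Γ) = ∑ L, q'(Γ_J, L) Q''(Γ/(J,L))`, where `J` is the set of the vertices
number `i, …, i+j-1`. -/
noncomputable def contractionComp {n j m : ℕ} (h : n + j = m + 1) (i : Fin n) :
    ContractionMap R C D n →ₗ[R] ContractionMap R C D j →ₗ[R] ContractionMap R C D m :=
  LinearMap.mk₂ R
    (fun Q'' Q' Γ K => ∑ L, Q' (Γ.sub h i) L * Q'' (Γ.contract h i L) K)
    (fun _ _ _ => by funext Γ K; simp [mul_add, Finset.sum_add_distrib])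
    (fun _ _ _ => by funext Γ K; simp [Finset.mul_sum, mul_left_comm])
    (fun _ _ _ => by funext Γ K; simp [add_mul, Finset.sum_add_distrib])
    (fun _ _ _ => by funext Γ K; simp [Finset.mul_sum, mul_assoc])

/-- The universal contraction operad, with vertex colors `C` and flag colors `D`. -/
noncomputable def contractionOperad : SymmetricOperad R where
  obj := ContractionMap R C D
  act := contractionAct R C D
  comp _ h i := contractionComp R C D h i
  act_one x := by
    funext Γ
    induction Γ using Quotient.inductionOn with
    | h Γ => rfl
  act_mul σ τ x := by
    funext Γ
    induction Γ using Quotient.inductionOn with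
    | h Γ => rfl
  comp_seq hj hk hp h₁ h₂ h₃ h₄ i a x y z := by
    funext Γ K
    induction Γ using Quotient.inductionOn with
    | h Γ =>
      simp only [contractionComp, LinearMap.mk₂_apply, Dgm.sub, Dgm.contract, Quotient.map_mk]
      simp only [Quotient.sound (Diagram.sub_sub h₁ h₂ h₃ h₄ i a Γ),
        fun M => Quotient.sound (Diagram.sub_contract hj h₁ h₂ h₃ h₄ i a M Γ),
        fun L M => Quotient.sound (Diagram.contract_contract hj hk h₁ h₂ h₃ h₄ i a L M Γ),
        Finset.mul_sum, Finset.sum_mul]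
      rw [Finset.sum_comm]
      simp only [mul_assoc]
  comp_par {n j k m p l} hj hk h₁ h₂ h₃ h₄ i i' hi x y z := by
    have hi' : (i : ℕ) < i' := hi
    funext Γ K
    induction Γ using Quotient.inductionOn with
    | h Γ =>
      simp only [contractionComp, LinearMap.mk₂_apply, Dgm.sub, Dgm.contract, Quotient.map_mk]
      simp only [
        fun M => Quotient.sound (Diagram.contract_sub_left hj hk h₁ h₂ h₄ i
          ⟨i' + j - 1, by omega⟩ ⟨i, by omega⟩ rfl (by simp only; omega) M Γ),
        fun L => Quotient.sound (Diagram.contract_sub_right hj hk h₂ h₃ h₄ i'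
          ⟨i' + j - 1, by omega⟩ ⟨i, by omega⟩ hi' rfl L Γ),
        fun L M => Quotient.sound (Diagram.contract_comm hj hk h₁ h₂ h₃ h₄ i i'
          ⟨i' + j - 1, by omega⟩ ⟨i, by omega⟩ hi' rfl rfl L M Γ),
        Finset.mul_sum]
      rw [Finset.sum_comm]
      simp only [mul_left_comm]
  comp_act hj h i σ τ ρ hρ x y := by
    funext Γ K
    induction Γ using Quotient.inductionOn with
    | h Γ =>
      simp only [contractionComp, contractionAct, LinearMap.mk₂_apply, LinearMap.coe_mk,
        AddHom.coe_mk, Dgm.sub, Dgm.contract, Dgm.perm, Quotient.map_mk]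
      simp only [Quotient.sound (Diagram.perm_sub hρ Γ),
        fun L => Quotient.sound (Diagram.perm_contract hj hρ L Γ)]

/-- The contraction maps with `n` vertices which vanish on all diagrams that are not 1PI. -/
def onePI (n : ℕ) : Set (ContractionMap R C D n) :=
  {Q | ∀ Γ : Diagram C D n, ¬ Γ.body.Is1PI → Q (Quotient.mk _ Γ) = 0}

end ContractionOperad

/-! Each summand of a composition is the product of a coefficient at `Γ_J` and one at `Γ/(J,L)`.
Closure under composition therefore follows from one graph-theoretic fact: if `Γ_J` and `Γ/(J,L)`
are both 1PI, so is `Γ` (`Is1PI.of_sub_of_contract`). For a non-1PI `Γ`, every summand then has a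
zero factor. Closure under renumbering holds because being 1PI does not depend on the numbering.

Topology enters only through a criterion: for nonempty `V`, the realization is connected iff every
nonempty saturated set of vertices is all of `V` (`Connected.mem_of_saturated`,
`connected_of_saturated`). A saturated set of `Γ` restricts to one of `Γ_J`, so it contains all or
none of `J`. It is then a union of fibres of the contraction and descends to a saturated set of the
contracted graph, where it is trivial (`Connected.of_sub_of_contract`).

The same argument applies to `Γ` with an edge cut. The edge is either an inner edge of `Γ_J`,
invisible after contraction, or an inner edge of the contracted graph, invisible in `Γ_J`; so one of
the two pieces is cut, the other is not, and both stay connected. A tadpole of `Γ` is likewise a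
tadpole of one of the two pieces, and `J` already supplies two vertices. -/

namespace FlagGraph

variable {V W F F' : Type*}

/-! ### Connectedness of the realization in terms of saturated sets. -/

/-- Sets of vertices which are unions of connected components. -/
def Saturated (G : FlagGraph V F) (S : Set V) : Prop :=
  ∀ f, G.att f ∈ S ↔ G.att (G.join f) ∈ S

theorem Connected.nonempty {G : FlagGraph V F} (h : G.Connected) : Nonempty V := by
  have h' : ConnectedSpace G.Realization := h
  obtain ⟨x⟩ := h'.toNonempty
  induction x using Quot.ind with
  | mk c =>
    rcases c with ⟨v, _⟩ | ⟨f, _⟩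
    · exact ⟨v⟩
    · exact ⟨G.att f⟩

/-- The indicator of `S`, extended constantly along the interval of each flag, respects the gluing.
It descends to a continuous `Bool`-valued function on the realization, which must be constant. -/
theorem Connected.mem_of_saturated {G : FlagGraph V F} (h : G.Connected) {S : Set V}
    (hS : G.Saturated S) {u v : V} (hu : u ∈ S) : v ∈ S := by
  classical
  have h' : ConnectedSpace G.Realization := h
  let c : Cells V F → Bool :=
    Sum.elim (fun x => decide (x.1 ∈ S)) (fun x => decide (G.att x.1 ∈ S))
  have hc : Continuous c := by
    refine continuous_sum_dom.2 ⟨continuous_sigma fun v => ?_, continuous_sigma fun f => ?_⟩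
    · exact continuous_const (X := Unit) (y := decide (v ∈ S))
    · exact continuous_const (X := unitInterval) (y := decide (G.att f ∈ S))
  have hg : ∀ a b, G.Glue a b → c a = c b := by
    intro a b hab
    cases hab with
    | start f => rfl
    | flip f t hf => simpa [c] using hS f
  have hq : Continuous (Quot.lift c hg : G.Realization → Bool) := continuous_quot_lift hg hc
  have e := PreconnectedSpace.constant h'.toPreconnectedSpace hq
    (x := Quot.mk _ (Sum.inl ⟨u, ()⟩)) (y := Quot.mk _ (Sum.inl ⟨v, ()⟩))
  have e' : decide (u ∈ S) = decide (v ∈ S) := e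
  simpa [hu] using e'

/-- A continuous `Bool`-valued function on the realization is constant along each flag, so it is
determined by its values on vertices, and its level sets there are saturated. Without `Nonempty V`
the hypothesis would be vacuous for the empty graph. -/
theorem connected_of_saturated {G : FlagGraph V F} [Nonempty V]
    (h : ∀ S, G.Saturated S → ∀ u v, u ∈ S → v ∈ S) : G.Connected := by
  let p : Cells V F → G.Realization := Quot.mk _
  have hp : Continuous p := continuous_quot_mk
  have hpre : PreconnectedSpace G.Realization := by
    refine preconnectedSpace_of_forall_constant fun g hg => ?_
    have hint : ∀ f t, g (p (Sum.inr ⟨f, t⟩)) = g (p (Sum.inl ⟨G.att f, ()⟩)) := by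
      intro f t
      have hc : Continuous fun t : unitInterval => g (p (Sum.inr ⟨f, t⟩)) :=
        hg.comp (hp.comp (continuous_inr.comp continuous_sigmaMk))
      have e := PreconnectedSpace.constant inferInstance hc (x := t) (y := 0)
      exact e.trans (congrArg g (Quot.sound (Glue.start f)))
    have hS : ∀ b, G.Saturated {v | g (p (Sum.inl ⟨v, ()⟩)) = b} := by
      intro b f
      by_cases hf : G.join f = f
      · rw [hf]
      -- One point of the common interval suffices, since `hint` carries its value to both end
      -- vertices.
      · have e : g (p (Sum.inr ⟨f, 0⟩)) = g (p (Sum.inr ⟨G.join f, unitInterval.symm 0⟩)) :=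
          congrArg g (Quot.sound (Glue.flip f 0 hf))
        rw [hint, hint] at e
        simp only [Set.mem_ofPred_eq, e]
    have hv : ∀ c, ∃ v, g (p c) = g (p (Sum.inl ⟨v, ()⟩)) := by
      rintro (⟨v, _⟩ | ⟨f, t⟩)
      · exact ⟨v, rfl⟩
      · exact ⟨_, hint f t⟩
    intro x y
    induction x using Quot.ind with
    | mk x =>
      induction y using Quot.ind with
      | mk y =>
        obtain ⟨u, hu⟩ := hv x
        obtain ⟨v, hv⟩ := hv y
        exact hu.trans ((h _ (hS _) v u rfl).trans hv.symm)
  exact { hpre with toNonempty := ⟨p (Sum.inl ⟨Classical.arbitrary V, ()⟩)⟩ }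

/-! ### Transfer of connectedness between graphs. -/

/-- Adding edges keeps a graph connected. -/
theorem Connected.mono {G : FlagGraph V F} {G' : FlagGraph V F'} (h : G.Connected)
    (he : ∀ f, G.att (G.join f) = G.att f ∨
      ∃ f', G'.att f' = G.att f ∧ G'.att (G'.join f') = G.att (G.join f)) : G'.Connected := by
  have := h.nonempty
  refine connected_of_saturated fun S hS u v hu => h.mem_of_saturated (fun f => ?_) hu
  -- External lines and tadpoles impose no condition on a saturated set.
  rcases he f with e | ⟨f', e₁, e₂⟩
  · rw [e]
  · rw [← e₁, ← e₂]
    exact hS f'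

/-- Images of saturated sets under an injection are saturated. Nonemptiness of `V` is not automatic:
a one-point `W` without flags is connected even if `V` is empty. -/
theorem Connected.of_mapVert {G : FlagGraph V F} {φ : V → W} (hφ : Function.Injective φ)
    [Nonempty V] (h : (G.mapVert φ).Connected) : G.Connected := by
  refine connected_of_saturated fun S hS u v hu => ?_
  have hT : (G.mapVert φ).Saturated (φ '' S) := fun f => by
    simpa only [mapVert, hφ.mem_set_image] using hS f
  exact hφ.mem_set_image.1 (h.mem_of_saturated hT (Set.mem_image_of_mem φ hu))

/-- A graph is connected if a subgraph and the graph obtained by contracting it are. -/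
theorem Connected.of_sub_of_contract {G : FlagGraph V F} {J : Set V} {φ : V → W}
    (hφ : ∀ x y, φ x = φ y → x = y ∨ x ∈ J ∧ y ∈ J) (hsub : (G.sub J).Connected)
    (hcon : ((G.eraseInner J).mapVert φ).Connected) : G.Connected := by
  obtain ⟨x₀⟩ := hsub.nonempty
  have : Nonempty V := ⟨x₀.1⟩
  refine connected_of_saturated fun S hS u v hu => ?_
  -- A flag leaving `J` is external in the subgraph, so saturation only has to be checked for edges
  -- inside `J`.
  have hJ : (G.sub J).Saturated (Subtype.val ⁻¹' S) := by
    intro f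
    change G.att f.1 ∈ S ↔ G.att ((G.sub J).join f).1 ∈ S
    by_cases hf : G.att (G.join f) ∈ J
    · rw [sub_join_pos G J f hf]
      exact hS f
    · rw [sub_join_neg G J f hf]
  -- Since `S` contains all or none of `J`, it is a union of fibres of `φ`.
  have himg : ∀ x, φ x ∈ φ '' S ↔ x ∈ S := by
    refine fun x => ⟨?_, Set.mem_image_of_mem φ⟩
    rintro ⟨s, hs, e⟩
    rcases hφ _ _ e with rfl | ⟨hsJ, hxJ⟩
    · exact hs
    · exact hsub.mem_of_saturated hJ (u := ⟨s, hsJ⟩) (v := ⟨x, hxJ⟩) hs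
  have hT : ((G.eraseInner J).mapVert φ).Saturated (φ '' S) := fun f =>
    (himg _).trans ((hS f).trans (himg _).symm)
  exact (himg v).1 (hcon.mem_of_saturated hT ((himg u).2 hu))

/-! ### Cutting an edge, compared with restriction and contraction. -/

theorem cut_join_of_mem (G : FlagGraph V F) {f g : F} (h : g = f ∨ g = G.join f) :
    (G.cut f).join g = g := by
  simp only [cut, if_pos h]

theorem cut_join_of_notMem (G : FlagGraph V F) {f g : F} (h : ¬ (g = f ∨ g = G.join f)) :
    (G.cut f).join g = G.join g := by
  simp only [cut, if_neg h]

theorem IsInner.join {G : FlagGraph V F} {J : Set V} {f : F} (h : G.IsInner J f) :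
    G.IsInner J (G.join f) :=
  ⟨h.2.1, by rw [G.join_join]; exact h.1, by rw [G.join_join]; exact h.2.2.symm⟩

/-- Cutting creates no inner edges, so every flag of `G.eraseInner J` is also a flag of `(G.cut
f).eraseInner J`. -/
theorem IsInner.of_cut {G : FlagGraph V F} {J : Set V} {f g : F} (h : (G.cut f).IsInner J g) :
    G.IsInner J g := by
  by_cases hg : g = f ∨ g = G.join f
  · exact absurd (G.cut_join_of_mem hg).symm h.2.2
  · have h' := h
    rw [IsInner, G.cut_join_of_notMem hg] at h'
    exact h'

/-- Cutting inside `J` commutes with restriction to `J`. As `cut` leaves `att` unchanged, both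
graphs have the same flags and `Connected.mono` can compare them flag by flag. -/
theorem sub_cut_connected_of_inner {G : FlagGraph V F} {J : Set V} {f : F} (hf : G.IsInner J f)
    (h : ((G.sub J).cut ⟨f, hf.1⟩).Connected) : ((G.cut f).sub J).Connected := by
  refine h.mono fun g => ?_
  have hjoin : ((G.sub J).join ⟨f, hf.1⟩).1 = G.join f := sub_join_pos G J ⟨f, hf.1⟩ hf.2.1
  by_cases hg : g.1 = f ∨ g.1 = G.join f
  · left
    rw [cut_join_of_mem]
    exact hg.imp (fun e => Subtype.ext e) (fun e => Subtype.ext (e.trans hjoin.symm))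
  · have hg' : ¬ (g = ⟨f, hf.1⟩ ∨ g = (G.sub J).join ⟨f, hf.1⟩) := fun e =>
      hg (e.imp (congrArg Subtype.val) fun e => (congrArg Subtype.val e).trans hjoin)
    refine Or.inr ⟨g, rfl, Subtype.ext ?_⟩
    rw [cut_join_of_notMem _ hg']
    change G.att (((G.cut f).sub J).join g).1 = G.att ((G.sub J).join g).1
    have e := G.cut_join_of_notMem hg
    by_cases hJ : G.att (G.join g) ∈ J
    · rw [sub_join_pos G J g hJ, sub_join_pos (G.cut f) J g (by rw [e]; exact hJ), e]
    · rw [sub_join_neg G J g hJ, sub_join_neg (G.cut f) J g (by rw [e]; exact hJ)]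

/-- The cut edge has an end outside `J`, so the edges of the subgraph are untouched. -/
theorem sub_cut_connected_of_not_inner {G : FlagGraph V F} {J : Set V} {f : F}
    (hne : G.join f ≠ f) (hf : ¬ G.IsInner J f) (h : (G.sub J).Connected) :
    ((G.cut f).sub J).Connected := by
  refine h.mono fun g => ?_
  by_cases hJ : G.att (G.join g) ∈ J
  · have hg : ¬ (g.1 = f ∨ g.1 = G.join f) := by
      rintro (e | e)
      · exact hf ⟨e ▸ g.2, e ▸ hJ, hne.symm⟩
      · rw [e, G.join_join] at hJ
        exact hf ⟨hJ, e ▸ g.2, hne.symm⟩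
    have e := G.cut_join_of_notMem hg
    refine Or.inr ⟨g, rfl, Subtype.ext ?_⟩
    change G.att (((G.cut f).sub J).join g).1 = G.att ((G.sub J).join g).1
    rw [sub_join_pos G J g hJ, sub_join_pos (G.cut f) J g (by rw [e]; exact hJ), e]
  · left
    rw [show (G.sub J).join g = g from Subtype.ext (sub_join_neg G J g hJ)]

/-- Contraction would erase the edge of `f` anyway. After the cut its two flags survive, but only as
external lines. -/
theorem contract_cut_connected_of_inner {G : FlagGraph V F} {J : Set V} {φ : V → W} {f : F}
    (hf : G.IsInner J f) (h : ((G.eraseInner J).mapVert φ).Connected) :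
    (((G.cut f).eraseInner J).mapVert φ).Connected := by
  refine h.mono fun g => Or.inr ⟨⟨g.1, fun hg => g.2 hg.of_cut⟩, rfl, ?_⟩
  have hg : ¬ (g.1 = f ∨ g.1 = G.join f) := by
    rintro (e | e)
    · exact g.2 (e ▸ hf)
    · exact g.2 (e ▸ hf.join)
  change φ (G.att ((G.cut f).join g.1)) = φ (G.att (G.join g.1))
  rw [cut_join_of_notMem G hg]

/-- An edge that contraction keeps may be cut before or after contracting. -/
theorem contract_cut_connected_of_not_inner {G : FlagGraph V F} {J : Set V} {φ : V → W} {f : F}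
    (hf : ¬ G.IsInner J f) (h : (((G.eraseInner J).mapVert φ).cut ⟨f, hf⟩).Connected) :
    (((G.cut f).eraseInner J).mapVert φ).Connected := by
  refine h.mono fun g => ?_
  by_cases hg : g.1 = f ∨ g.1 = G.join f
  · left
    rw [cut_join_of_mem]
    exact hg.imp (fun e => Subtype.ext e) (fun e => Subtype.ext e)
  · have hg' : ¬ (g = ⟨f, hf⟩ ∨ g = ((G.eraseInner J).mapVert φ).join ⟨f, hf⟩) := fun e =>
      hg (e.imp (congrArg Subtype.val) (congrArg Subtype.val))
    refine Or.inr ⟨⟨g.1, fun hg => g.2 hg.of_cut⟩, rfl, ?_⟩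
    rw [cut_join_of_notMem _ hg']
    change φ (G.att ((G.cut f).join g.1)) = φ (G.att (G.join g.1))
    rw [cut_join_of_notMem G hg]

/-! ### 1PI graphs under renaming and contraction. -/

theorem Is1PI.of_mapVert {G : FlagGraph V F} (e : V ≃ W) (h : (G.mapVert e).Is1PI) :
    G.Is1PI := by
  obtain ⟨hc, hcut, ht, hcard⟩ := h
  have : Nonempty V := hc.nonempty.map e.symm
  -- Cutting commutes definitionally with renaming the vertices.
  refine ⟨hc.of_mapVert e.injective, fun f hf => (hcut f hf).of_mapVert (φ := e) e.injective,
    ?_, ?_⟩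
  · rintro ⟨f, hf, ha⟩
    exact ht ⟨f, hf, congrArg e ha⟩
  · rwa [Nat.card_congr e]

/-- A graph is 1PI if a subgraph and the graph obtained by contracting it are. -/
theorem Is1PI.of_sub_of_contract {G : FlagGraph V F} [Finite V] {J : Set V} {φ : V → W}
    (hφ : ∀ x y, φ x = φ y → x = y ∨ x ∈ J ∧ y ∈ J) (hsub : (G.sub J).Is1PI)
    (hcon : ((G.eraseInner J).mapVert φ).Is1PI) : G.Is1PI := by
  obtain ⟨sc, scut, st, scard⟩ := hsub
  obtain ⟨cc, ccut, ct, -⟩ := hcon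
  refine ⟨sc.of_sub_of_contract hφ cc, fun f hne => ?_, ?_,
    scard.trans (Nat.card_le_card_of_injective _ Subtype.val_injective)⟩
  -- Inside `J` the 1PI property of the subgraph absorbs the cut; otherwise that of the contracted
  -- graph does.
  · by_cases hf : G.IsInner J f
    · refine (sub_cut_connected_of_inner hf (scut _ fun e => hne ?_)).of_sub_of_contract hφ
        (contract_cut_connected_of_inner hf cc)
      rw [← sub_join_pos G J ⟨f, hf.1⟩ hf.2.1, e]
    · exact (sub_cut_connected_of_not_inner hne hf sc).of_sub_of_contract hφ
        (contract_cut_connected_of_not_inner hf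
          (ccut _ fun e => hne (congrArg Subtype.val e)))
  · rintro ⟨f, hne, ha⟩
    -- A tadpole at a vertex of `J` is inner and lies in the subgraph; any other survives
    -- contraction.
    by_cases hf : G.IsInner J f
    · have e := sub_join_pos G J ⟨f, hf.1⟩ hf.2.1
      refine st ⟨⟨f, hf.1⟩, fun e' => hne (by rw [← e, e']), Subtype.ext ?_⟩
      change G.att ((G.sub J).join ⟨f, hf.1⟩).1 = G.att f
      rw [e, ha]
    · exact ct ⟨⟨f, hf⟩, fun e => hne (congrArg Subtype.val e), congrArg φ ha⟩

end FlagGraph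

/-! ### Blocks of consecutive numbers and the suboperad property. -/

/-- The enumeration of a block. -/
def blockEquiv {n j m : ℕ} (h : n + j = m + 1) (i : Fin n) : blockSet m i j ≃ Fin j where
  toFun := blockIndex
  invFun a := ⟨blockIncl h i a, by simp [blockSet, blockIncl]⟩
  left_inv x := by
    have := x.2.1
    apply Subtype.ext
    apply Fin.ext
    simp only [blockIncl, blockIndex]
    omega
  right_inv a := by
    apply Fin.ext
    simp [blockIncl, blockIndex]

theorem collapse_eq_collapse {n j m : ℕ} (h : n + j = m + 1) (i : Fin n) (x y : Fin m)
    (e : collapse h i x = collapse h i y) :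
    x = y ∨ x ∈ blockSet m i j ∧ y ∈ blockSet m i j := by
  rw [Fin.ext_iff, collapse_val, collapse_val] at e
  have h1 := collapseNat_spec i j x
  have h2 := collapseNat_spec i j y
  rw [Fin.ext_iff]
  simp only [blockSet, Set.mem_ofPred_eq]
  omega

/-- The body of `Γ.sub h i` is the subgraph renamed along `blockIndex`, the map underlying
`blockEquiv`, so the renaming can be undone. Being 1PI ignores colors, so any `L` will do. -/
theorem Diagram.is1PI_of_sub_of_contract {C D : Type*} {n j m : ℕ} (h : n + j = m + 1)
    (i : Fin n) (L : C) (Γ : Diagram C D m) (hsub : (Γ.sub h i).body.Is1PI)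
    (hcon : (Γ.contract h i L).body.Is1PI) : Γ.body.Is1PI :=
  FlagGraph.Is1PI.of_sub_of_contract (collapse_eq_collapse h i)
    (FlagGraph.Is1PI.of_mapVert (blockEquiv h i) hsub) hcon

/-- The contraction maps that vanish on all non-1PI diagrams form a suboperad of the universal
contraction operad. -/
theorem mainTheorem9 (R : Type*) [CommRing R] (C D : Type*) [Fintype C] :
    (contractionOperad R C D).IsSuboperad (onePI R C D) where
  zero_mem _ _ _ := rfl
  add_mem {n} _ x y hx hy Γ hΓ := by
    change (x : ContractionMap R C D n) _ + (y : ContractionMap R C D n) _ = 0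
    rw [hx Γ hΓ, hy Γ hΓ, add_zero]
  smul_mem {n} _ c x hx Γ hΓ := by
    change c • (x : ContractionMap R C D n) _ = 0
    rw [hx Γ hΓ, smul_zero]
  act_mem _ σ x hx Γ hΓ := hx (Γ.perm σ) fun h => hΓ (h.of_mapVert σ)
  comp_mem {n j m} hj h i x y hx hy Γ hΓ := by
    funext K
    refine Finset.sum_eq_zero fun L _ => ?_
    change (y : ContractionMap R C D j) (Quotient.mk _ (Γ.sub h i)) L *
      (x : ContractionMap R C D n) (Quotient.mk _ (Γ.contract h i L)) K = 0
    -- If `Γ_J` is 1PI then the contracted diagram is not, and `x` vanishes on it; otherwise `y`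
    -- vanishes on `Γ_J`.
    by_cases hsub : (Γ.sub h i).body.Is1PI
    · rw [hx (Γ.contract h i L) fun hcon => hΓ (Γ.is1PI_of_sub_of_contract h i L hsub hcon)]
      exact mul_zero _
    · rw [hy (Γ.sub h i) hsub]
      exact zero_mul _
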